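/- Let $\Lambda,\Omega$ be countably infinite sets, and let $\mathcal F$ be a nonempty family of infinite subsets of $\Omega$ such that $F\setminus K\in\mathcal F$ for every $F\in\mathcal F$ and every finite $K\subseteq\Omega$. A function $\rho$ from $\mathcal F$ to the infinite subsets of $\Lambda$ is *partition regular* if - (M) $E\subseteq F$ implies $\rho(E)\subseteq\rho(F)$ for all $E,F\in\mathcal F$; - (R) if $F\in\mathcal F$ and $\rho(F)=A\cup B$, then there is $E\in\mathcal F$ with $\rho(E)\subseteq A$ or $\rho(E)\subseteq B$; - (S) for every $F\in\mathcal F$ there is $E\in\mathcal F$ with $E\subseteq F$ such that for every $a\in\rho(E)$ there is a finite $K\subseteq\Omega$ with $a\notin\rho(E\setminus K)$. Let $\mathcal I_\rho=\{A\subseteq\Lambda:\rho(F)\not\subseteq A\text{ for all }F\in\mathcal F\}$ and $\mathcal I_\rho^+=\mathcal P(\Lambda)\setminus\mathcal I_\rho$. Write $\rho(F)\subseteq^\rho B$ if $\rho(F\setminus K)\subseteq B$ for some finite $K\subseteq\Omega$. The function $\rho$ is - *tall* if every infinite $A\subseteq\Lambda$ contains an infinite $B\in\mathcal I_\rho$;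 - $P^+$ if for every $\subseteq$-decreasing sequence $(A_n)_{n\in\omega}$ in $\mathcal I_\rho^+$ there is $F\in\mathcal F$ with $\rho(F)\subseteq^\rho A_n$ for all $n$; - $P^-$ if this holds for all such sequences with $A_n\setminus A_{n+1}\in\mathcal I_\rho$ for all $n$; - $P^-(\Lambda)$ if this holds for all such sequences with $A_n\setminus A_{n+1}\in\mathcal I_\rho$ for all $n$ and $A_0=\Lambda$; - *weak* $P^+$ if for every $E\in\mathcal F$ there is $F\in\mathcal F$ with $\rho(F)\subseteq\rho(E)$ such that for every sequence $(F_n)_{n\in\omega}$ in $\mathcal F$ with $\rho(F)\supseteq\rho(F_n)\supseteq\rho(F_{n+1})$ for all $n$ there is $G\in\mathcal F$ with $\rho(G)\subseteq^\rho\rho(F_n)$ for all $n$. For a topological space $X$, a function $f:\rho(F)\to X$ (with $F\in\mathcal F$) is *$\rho$-convergent* to $x\in X$ if for every neighbourhood $U$ of $x$ there is a finite $K\subseteq\Omega$ with $f[\rho(F\setminus K)]\subseteq U$. $\mathrm{FinBW}(\rho)$ is the class of all spaces $X$ such that for every $f:\Lambda\to X$ there is $F\in\mathcal F$ with $f\restriction\rho(F)$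 $\rho$-convergent to some point of $X$. $\mathrm{hFinBW}(\rho)$ is the class of all spaces $X$ such that for every $E\in\mathcal F$ and $f:\rho(E)\to X$ there is $F\in\mathcal F$ with $\rho(F)\subseteq\rho(E)$ and $f\restriction\rho(F)$ $\rho$-convergent to some point of $X$. **Theorem.** Let $\rho$ be partition regular. 1. $\mathrm{FinBW}(\rho)$ contains all finite spaces, and every space in $\mathrm{FinBW}(\rho)$ is sequentially compact. 2. $\rho$ is not tall if and only if $\mathrm{FinBW}(\rho)$ coincides with the class of all sequentially compact spaces. (This holds both for the classes of all topological spaces and for the classes of Hausdorff spaces.) 3. The following are equivalent: (a) $\rho$ is $P^-(\Lambda)$; (b) for every cardinal $\kappa$ there is a compact Hausdorff space of cardinality $\kappa$ in $\mathrm{FinBW}(\rho)$; (c) there is an infinite Hausdorff space in $\mathrm{FinBW}(\rho)$. 4. The following are equivalent: (a) $\rho$ is $P^-$; (b) for every cardinal $\kappa$ there is a compact Hausdorff space of cardinality $\kappa$ in $\mathrm{hFinBW}(\rho)$; (c) there is an infinite Hausdorff space in $\mathrm{hFinBW}(\rho)$. 5. If $\rho$ is $P^-$, then (a) the uncountable,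 non-compact Hausdorff space $\omega_1$ with the order topology belongs to $\mathrm{FinBW}(\rho)$; (b) assuming the Continuum Hypothesis, there is a compact separable Hausdorff space of cardinality $\mathfrak c$ in $\mathrm{FinBW}(\rho)$. 6. If $\rho$ is weak $P^+$, then every compact metric space belongs to $\mathrm{hFinBW}(\rho)$. 7. If $\rho$ is $P^+$, then every Hausdorff space $X$ such that the closure of every countable $D\subseteq X$ is compact and first-countable belongs to $\mathrm{hFinBW}(\rho)$. -/

import Mathlib

open Set Topology

universe u v w

/-- A partition regular function `ρ : 𝓕 → [Λ]^ω`, where `𝓕` is a nonempty family of infinite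
subsets of `Ω` that is closed under removing finite sets. The function is represented by a total
function `Set Ω → Set Λ`; only its values on members of `𝓕` are constrained, and only these values
are used in the notions below. (When `Λ` is countable, the infinite subsets of `Λ` are exactly the
members of `[Λ]^ω`.) -/
structure PartitionRegularFunction (Ω : Type u) (Λ : Type v) where
  /-- The family `𝓕` on which `ρ` is defined. -/
  family : Set (Set Ω)
  /-- The function `ρ`. -/
  toFun : Set Ω → Set Λ
  family_nonempty : family.Nonempty
  infinite_of_mem : ∀ F ∈ family, F.Infinite
  diff_mem : ∀ F ∈ family, ∀ K : Set Ω, K.Finite → F \ K ∈ family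
  infinite_toFun : ∀ F ∈ family, (toFun F).Infinite
  /-- Condition (M): monotonicity. -/
  monotone' : ∀ E ∈ family, ∀ F ∈ family, E ⊆ F → toFun E ⊆ toFun F
  /-- Condition (R): partition regularity. -/
  regular' : ∀ F ∈ family, ∀ A B : Set Λ, toFun F = A ∪ B →
    ∃ E ∈ family, toFun E ⊆ A ∨ toFun E ⊆ B
  /-- Condition (S): finite supports. -/
  support' : ∀ F ∈ family, ∃ E ∈ family, E ⊆ F ∧
    ∀ a ∈ toFun E, ∃ K : Set Ω, K.Finite ∧ a ∉ toFun (E \ K)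

namespace PartitionRegularFunction

variable {Ω : Type u} {Λ : Type v}

instance : CoeFun (PartitionRegularFunction Ω Λ) (fun _ => Set Ω → Set Λ) := ⟨toFun⟩

/-- The ideal `I_ρ` of all subsets of `Λ` that contain no set `ρ(F)`, `F ∈ 𝓕`. -/
def ideal (ρ : PartitionRegularFunction Ω Λ) : Set (Set Λ) :=
  {A | ∀ F ∈ ρ.family, ¬ ρ F ⊆ A}

/-- `ρ` is tall: every infinite subset of `Λ` contains an infinite set from `I_ρ`. -/
def Tall (ρ : PartitionRegularFunction Ω Λ) : Prop :=
  ∀ A : Set Λ, A.Infinite → ∃ B : Set Λ, B ⊆ A ∧ B.Infinite ∧ B ∈ ρ.ideal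

/-- The relation `ρ(F) ⊆^ρ B`: there is a finite `K ⊆ Ω` with `ρ(F \ K) ⊆ B`. -/
def AlmostSubset (ρ : PartitionRegularFunction Ω Λ) (F : Set Ω) (B : Set Λ) : Prop :=
  ∃ K : Set Ω, K.Finite ∧ ρ (F \ K) ⊆ B

/-- `ρ` is `P⁻(Λ)`. -/
def IsPMinusWhole (ρ : PartitionRegularFunction Ω Λ) : Prop :=
  ∀ A : ℕ → Set Λ, A 0 = univ → (∀ n, A (n + 1) ⊆ A n) → (∀ n, A n ∉ ρ.ideal) →
    (∀ n, A n \ A (n + 1) ∈ ρ.ideal) →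
    ∃ F ∈ ρ.family, ∀ n, ρ.AlmostSubset F (A n)

/-- `ρ` is `P⁻`. -/
def IsPMinus (ρ : PartitionRegularFunction Ω Λ) : Prop :=
  ∀ A : ℕ → Set Λ, (∀ n, A (n + 1) ⊆ A n) → (∀ n, A n ∉ ρ.ideal) →
    (∀ n, A n \ A (n + 1) ∈ ρ.ideal) →
    ∃ F ∈ ρ.family, ∀ n, ρ.AlmostSubset F (A n)

/-- `ρ` is `P⁺`. -/
def IsPPlus (ρ : PartitionRegularFunction Ω Λ) : Prop :=
  ∀ A : ℕ → Set Λ, (∀ n, A (n + 1) ⊆ A n) → (∀ n, A n ∉ ρ.ideal) →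
    ∃ F ∈ ρ.family, ∀ n, ρ.AlmostSubset F (A n)

/-- `ρ` is weak `P⁺`. -/
def IsWeakPPlus (ρ : PartitionRegularFunction Ω Λ) : Prop :=
  ∀ E ∈ ρ.family, ∃ F ∈ ρ.family, ρ F ⊆ ρ E ∧
    ∀ S : ℕ → Set Ω, (∀ n, S n ∈ ρ.family) → (∀ n, ρ (S n) ⊆ ρ F) →
      (∀ n, ρ (S (n + 1)) ⊆ ρ (S n)) →
      ∃ G ∈ ρ.family, ∀ n, ρ.AlmostSubset G (ρ (S n))

/-- The `ρ`-sequence `f : ρ(F) → X` is `ρ`-convergent to `x`: every neighbourhood `U` of `x`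
contains `f[ρ(F \ K)]` for some finite `K ⊆ Ω`. -/
def ConvergesTo (ρ : PartitionRegularFunction Ω Λ) {X : Type w} [TopologicalSpace X]
    (F : Set Ω) (f : ρ F → X) (x : X) : Prop :=
  ∀ U ∈ 𝓝 x, ∃ K : Set Ω, K.Finite ∧ ∀ a : ρ F, (a : Λ) ∈ ρ (F \ K) → f a ∈ U

/-- `X` belongs to the class `FinBW(ρ)`: for every `f : Λ → X` there is `F ∈ 𝓕` such that the
restriction of `f` to `ρ(F)` is `ρ`-convergent to some point. -/
def FinBW (ρ : PartitionRegularFunction Ω Λ) (X : Type w) [TopologicalSpace X] : Prop :=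
  ∀ f : Λ → X, ∃ F ∈ ρ.family, ∃ x : X, ρ.ConvergesTo F (fun a => f a) x

/-- `X` belongs to the class `hFinBW(ρ)`: for every `ρ`-sequence `f : ρ(E) → X` there is `F ∈ 𝓕`
with `ρ(F) ⊆ ρ(E)` such that the restriction of `f` to `ρ(F)` is `ρ`-convergent to some point. -/
def HFinBW (ρ : PartitionRegularFunction Ω Λ) (X : Type w) [TopologicalSpace X] : Prop :=
  ∀ E ∈ ρ.family, ∀ f : ρ E → X, ∃ F ∈ ρ.family, ∃ h : ρ F ⊆ ρ E, ∃ x : X,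
    ρ.ConvergesTo F (fun a => f (Set.inclusion h a)) x

end PartitionRegularFunction

/-- Property (*): the closure of every countable set is compact and first-countable (as a
subspace). -/
def PropertyStar (X : Type w) [TopologicalSpace X] : Prop :=
  ∀ D : Set X, D.Countable → IsCompact (closure D) ∧ FirstCountableTopology (closure D)

/-- The set `ω₁` of all countable ordinals. -/
def OmegaOne : Type w := (Ordinal.omega.{w} 1).ToType

noncomputable instance : LinearOrder OmegaOne.{w} :=
  inferInstanceAs (LinearOrder (Ordinal.omega.{w} 1).ToType)

/-- `ω₁` carries the order topology. -/
noncomputable instance : TopologicalSpace OmegaOne.{w} := Preorder.topology OmegaOne.{w}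

instance : OrderTopology OmegaOne.{w} := ⟨rfl⟩

/-!
A function `f` is `ρ`-convergent on `ρ(F)` iff it converges along the filter generated by the sets
`ρ(F \ K)`, `K` finite. Condition (M) makes these sets a filter basis, (R) makes `I_ρ` an ideal, and
by (S) the filter can be refined below the cofinite one.

In this language `P⁻` below `B` says that countably many small sets can be avoided simultaneously by
the tail of a single `ρ(F) ⊆ B`. If all fibres of `f` are small, avoiding them makes `f` tend to
infinity, so one-point compactifications of discrete spaces belong to the class; for `ω₁` one avoids
all initial segments below the least one with a large preimage. Conversely, a map into an infinite
discrete subset of a Hausdorff space, recording the first small set that contains a given point,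
converges only if these small sets are avoided.

If `ρ` is tall, then there is a maximal almost disjoint family of infinite sets in `I_ρ`. The
one-point compactification of its Mrówka space is sequentially compact, but the inclusion of `Λ` as
the set of isolated points has no `ρ`-convergent restriction.

Under the continuum hypothesis, all pairs of a set `B ⊆ Λ` and a map `g : Λ → ℕ` are enumerated by
`ω₁`, and an `⊆*`-decreasing tower `T i` of subsets of `ℕ` is built together with sets `A i` split
off from it, such that `T i` has a small preimage under the `i`-th map whenever `A i` has. If the
preimages of all `A i` are small, it suffices to avoid `T i` and the countably many `A j` with
`j ≤ i` in order to avoid all of them.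
-/

open Filter
open scoped Function

theorem isCountablyGenerated_cofinite {α : Type*} [Countable α] :
    (cofinite : Filter α).IsCountablyGenerated := by
  obtain ⟨e, he⟩ := exists_injective_nat α
  rw [← he.comap_cofinite_eq, Nat.cofinite_eq_atTop]
  infer_instance

theorem tendsto_cofinite_iff_eventually_ne {α β : Type*} {l : Filter α} {f : α → β} :
    Tendsto f l cofinite ↔ ∀ b, ∀ᶠ a in l, f a ≠ b :=
  le_cofinite_iff_eventually_ne

theorem infinite_range_of_tendsto_cofinite {α β : Type*} {l : Filter α} [l.NeBot] {f : α → β}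
    (hf : Tendsto f l cofinite) : (range f).Infinite := fun hfin =>
  let ⟨a, ha⟩ := (hf.eventually hfin.eventually_cofinite_notMem).exists
  ha (mem_range_self a)

theorem finite_range_sdiff_of_eventually_mem {α : Type*} {b : ℕ → α} {s : Set α}
    (h : ∀ᶠ n in atTop, b n ∈ s) : (range b \ s).Finite := by
  rw [← Nat.cofinite_eq_atTop] at h
  refine ((eventually_cofinite.1 h).image b).subset ?_
  rintro _ ⟨⟨n, rfl⟩, hn⟩
  exact mem_image_of_mem b hn

theorem cofinite_le_nhds_onePoint_infty {X : Type*} [TopologicalSpace X] [DiscreteTopology X] :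
    (cofinite : Filter (OnePoint X)) ≤ 𝓝 OnePoint.infty :=
  OnePoint.le_nhds_infty.2 fun s _ hs => by
    rw [← OnePoint.compl_image_coe]
    exact (hs.finite_of_discrete.image _).compl_mem_cofinite

namespace PartitionRegularFunction

variable {Ω Λ X : Type*} {ρ : PartitionRegularFunction Ω Λ} {A B : Set Λ} {E F : Set Ω}

/-! ### The ideal of a partition regular function -/

theorem exists_toFun_subset (hA : A ∉ ρ.ideal) : ∃ F ∈ ρ.family, ρ F ⊆ A := by
  simpa [ideal] using hA

theorem notMem_ideal_of_toFun_subset (hF : F ∈ ρ.family) (h : ρ F ⊆ A) : A ∉ ρ.ideal :=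
  fun hA => hA F hF h

theorem toFun_notMem_ideal (hF : F ∈ ρ.family) : ρ F ∉ ρ.ideal :=
  notMem_ideal_of_toFun_subset hF Subset.rfl

theorem mem_ideal_of_subset (hB : B ∈ ρ.ideal) (h : A ⊆ B) : A ∈ ρ.ideal :=
  fun F hF hFA => hB F hF (hFA.trans h)

theorem union_mem_ideal (hA : A ∈ ρ.ideal) (hB : B ∈ ρ.ideal) : A ∪ B ∈ ρ.ideal := by
  intro F hF hFAB
  have hsplit : ρ F = (ρ F ∩ A) ∪ (ρ F ∩ B) := by
    rw [← inter_union_distrib_left, inter_eq_left.2 hFAB]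
  obtain ⟨E, hE, hEA | hEB⟩ := ρ.regular' F hF _ _ hsplit
  · exact hA E hE (hEA.trans inter_subset_right)
  · exact hB E hE (hEB.trans inter_subset_right)

theorem mem_ideal_of_finite (hA : A.Finite) : A ∈ ρ.ideal :=
  fun F hF h => ρ.infinite_toFun F hF (hA.subset h)

theorem infinite_of_notMem_ideal (hA : A ∉ ρ.ideal) : A.Infinite :=
  fun h => hA (mem_ideal_of_finite h)

theorem univ_notMem_ideal : univ ∉ ρ.ideal :=
  let ⟨_, hF⟩ := ρ.family_nonempty
  notMem_ideal_of_toFun_subset hF (subset_univ _)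

theorem biUnion_mem_ideal {ι : Type*} {s : Set ι} (hs : s.Finite) {C : ι → Set Λ}
    (hC : ∀ i ∈ s, C i ∈ ρ.ideal) : ⋃ i ∈ s, C i ∈ ρ.ideal := by
  induction s, hs using Set.Finite.induction_on with
  | empty => simpa using mem_ideal_of_finite finite_empty
  | insert _ _ ih =>
    rw [biUnion_insert]
    exact union_mem_ideal (hC _ (mem_insert _ _)) (ih fun i hi => hC i (mem_insert_of_mem _ hi))

theorem exists_inter_notMem_ideal {ι : Type*} {s : Set ι} (hs : s.Finite) {C : ι → Set Λ}
    (hB : B ∉ ρ.ideal) (hcover : B ⊆ ⋃ i ∈ s, C i) : ∃ i ∈ s, B ∩ C i ∉ ρ.ideal := by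
  by_contra! hsmall
  refine hB (mem_ideal_of_subset (biUnion_mem_ideal hs hsmall) ?_)
  rw [← inter_iUnion₂]
  exact subset_inter Subset.rfl hcover

/-! ### Convergence along tails -/

/-- The filter of all `B` with `ρ(F) ⊆^ρ B`. A function on `Λ` is `ρ`-convergent on `ρ(F)` iff it
converges along this filter. -/
def tail (ρ : PartitionRegularFunction Ω Λ) (F : Set Ω) : Filter Λ :=
  ⨅ K : Finset Ω, 𝓟 (ρ (F \ K))

instance [Countable Ω] : (ρ.tail F).IsCountablyGenerated :=
  iInf.isCountablyGenerated _

theorem toFun_sdiff_subset_toFun_sdiff (hE : E ∈ ρ.family) (hF : F ∈ ρ.family) (hEF : E ⊆ F)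
    {K L : Set Ω} (hK : K.Finite) (hL : L.Finite) (hKL : K ⊆ L) : ρ (E \ L) ⊆ ρ (F \ K) :=
  ρ.monotone' _ (ρ.diff_mem E hE L hL) _ (ρ.diff_mem F hF K hK) (sdiff_subset_sdiff hEF hKL)

theorem mem_tail (hF : F ∈ ρ.family) : B ∈ ρ.tail F ↔ ρ.AlmostSubset F B := by
  classical
  have hdir : Directed (· ≥ ·) fun K : Finset Ω => ρ (F \ K) :=
    directed_of_isDirected_le fun K L hKL => toFun_sdiff_subset_toFun_sdiff hF hF Subset.rfl
      K.finite_toSet L.finite_toSet (Finset.coe_subset.2 hKL)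
  rw [tail, (hasBasis_iInf_principal hdir).mem_iff, AlmostSubset, exists_finite_iff_finset]
  simp only [true_and]

theorem toFun_mem_tail (hF : F ∈ ρ.family) : ρ F ∈ ρ.tail F :=
  (mem_tail hF).2 ⟨∅, finite_empty, by rw [sdiff_empty]⟩

theorem eventually_mem_tail (hF : F ∈ ρ.family) (hFB : ρ F ⊆ B) : ∀ᶠ a in ρ.tail F, a ∈ B :=
  mem_of_superset (toFun_mem_tail hF) hFB

theorem tail_le_tail (hE : E ∈ ρ.family) (hF : F ∈ ρ.family) (hEF : E ⊆ F) :
    ρ.tail E ≤ ρ.tail F :=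
  iInf_mono fun K => principal_mono.2 <|
    toFun_sdiff_subset_toFun_sdiff hE hF hEF K.finite_toSet K.finite_toSet Subset.rfl

theorem exists_tail_le_of_mem_tail (hF : F ∈ ρ.family) (hB : B ∈ ρ.tail F) :
    ∃ E ∈ ρ.family, ρ E ⊆ B ∧ ρ.tail E ≤ ρ.tail F :=
  let ⟨K, hK, hKB⟩ := (mem_tail hF).1 hB
  ⟨F \ K, ρ.diff_mem F hF K hK, hKB, tail_le_tail (ρ.diff_mem F hF K hK) hF sdiff_subset⟩

theorem notMem_ideal_of_mem_tail (hF : F ∈ ρ.family) (hB : B ∈ ρ.tail F) : B ∉ ρ.ideal :=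
  let ⟨_, hE, hEB, _⟩ := exists_tail_le_of_mem_tail hF hB
  notMem_ideal_of_toFun_subset hE hEB

theorem tail_inf_cofinite_neBot (hF : F ∈ ρ.family) : (ρ.tail F ⊓ cofinite).NeBot := by
  refine inf_neBot_iff.2 fun {s} hs {t} ht => ?_
  have hs : s.Infinite := infinite_of_notMem_ideal (notMem_ideal_of_mem_tail hF hs)
  have ht : tᶜ.Finite := ht
  simpa only [sdiff_compl] using (hs.sdiff ht).nonempty

theorem tail_neBot (hF : F ∈ ρ.family) : (ρ.tail F).NeBot :=
  (tail_inf_cofinite_neBot hF).mono inf_le_left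

theorem exists_seq_tendsto_tail [Countable Ω] [Countable Λ] (hF : F ∈ ρ.family) :
    ∃ b : ℕ → Λ, Tendsto b atTop (ρ.tail F) ∧ Tendsto b atTop cofinite := by
  have := isCountablyGenerated_cofinite (α := Λ)
  have := tail_inf_cofinite_neBot hF
  obtain ⟨b, hb⟩ := exists_seq_tendsto (ρ.tail F ⊓ cofinite)
  exact ⟨b, tendsto_inf.1 hb⟩

theorem exists_tail_le_cofinite (hF : F ∈ ρ.family) :
    ∃ E ∈ ρ.family, ρ E ⊆ ρ F ∧ ρ.tail E ≤ cofinite := by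
  obtain ⟨E, hE, hEF, hsupp⟩ := ρ.support' F hF
  refine ⟨E, hE, ρ.monotone' E hE F hF hEF, le_cofinite_iff_eventually_ne.2 fun a => ?_⟩
  by_cases ha : a ∈ ρ E
  · obtain ⟨K, hK, haK⟩ := hsupp a ha
    exact (mem_tail hE).2 ⟨K, hK, fun b hb hba => haK (hba ▸ hb)⟩
  · exact eventually_mem_tail hE fun b hb hba => ha (hba ▸ hb)

/-- Some restriction of `f` to a set `ρ(F) ⊆ B` is `ρ`-convergent. -/
def ConvergesBelow (ρ : PartitionRegularFunction Ω Λ) [TopologicalSpace X] (B : Set Λ)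
    (f : Λ → X) : Prop :=
  ∃ F ∈ ρ.family, ρ F ⊆ B ∧ ∃ x, Tendsto f (ρ.tail F) (𝓝 x)

section ConvergesBelow

variable [TopologicalSpace X] {f : Λ → X} {x : X}

theorem convergesTo_restrict_iff (hF : F ∈ ρ.family) :
    ρ.ConvergesTo F (fun a => f a) x ↔ Tendsto f (ρ.tail F) (𝓝 x) := by
  refine forall₂_congr fun U _ => ?_
  rw [mem_map, mem_tail hF]
  refine exists_congr fun K => and_congr_right fun hK => ⟨fun h a ha => ?_, fun h a ha => h ha⟩
  refine h ⟨a, ?_⟩ ha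
  exact ρ.monotone' _ (ρ.diff_mem F hF K hK) F hF sdiff_subset ha

theorem finBW_iff : ρ.FinBW X ↔ ∀ f : Λ → X, ρ.ConvergesBelow univ f := by
  refine forall_congr' fun f => exists_congr fun F => and_congr_right fun hF => ?_
  simp only [convergesTo_restrict_iff hF, subset_univ, true_and]

theorem hFinBW_iff : ρ.HFinBW X ↔ ∀ B ∉ ρ.ideal, ∀ f : Λ → X, ρ.ConvergesBelow B f := by
  constructor
  · intro h B hB f
    obtain ⟨E, hE, hEB⟩ := exists_toFun_subset hB
    obtain ⟨F, hF, hFE, x, hx⟩ := h E hE fun a => f a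
    exact ⟨F, hF, hFE.trans hEB, x, (convergesTo_restrict_iff hF).1 hx⟩
  · intro h E hE f
    have : Nonempty X := (ρ.infinite_toFun E hE).nonempty.to_subtype.map f
    obtain ⟨g, rfl⟩ := Subtype.val_injective.surjective_comp_right f
    obtain ⟨F, hF, hFE, x, hx⟩ := h (ρ E) (toFun_notMem_ideal hE) g
    exact ⟨F, hF, hFE, x, (convergesTo_restrict_iff hF).2 hx⟩

theorem HFinBW.finBW (h : ρ.HFinBW X) : ρ.FinBW X :=
  finBW_iff.2 (hFinBW_iff.1 h univ univ_notMem_ideal)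

theorem convergesBelow_of_tendsto (hF : F ∈ ρ.family) (hB : B ∈ ρ.tail F)
    (hf : Tendsto f (ρ.tail F) (𝓝 x)) : ρ.ConvergesBelow B f :=
  let ⟨E, hE, hEB, hle⟩ := exists_tail_le_of_mem_tail hF hB
  ⟨E, hE, hEB, x, hf.mono_left hle⟩

theorem ConvergesBelow.mono (h : ρ.ConvergesBelow A f) (hAB : A ⊆ B) : ρ.ConvergesBelow B f :=
  let ⟨F, hF, hFA, hlim⟩ := h
  ⟨F, hF, hFA.trans hAB, hlim⟩

theorem convergesBelow_of_fiber_notMem_ideal (h : B ∩ f ⁻¹' {x} ∉ ρ.ideal) :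
    ρ.ConvergesBelow B f := by
  obtain ⟨F, hF, hFB⟩ := exists_toFun_subset h
  refine ⟨F, hF, hFB.trans inter_subset_left, x, tendsto_const_nhds.congr' ?_⟩
  filter_upwards [toFun_mem_tail hF] with a ha using (hFB ha).2.symm

theorem convergesBelow_of_finite [Finite X] (hB : B ∉ ρ.ideal) (f : Λ → X) :
    ρ.ConvergesBelow B f := by
  obtain ⟨x, -, hx⟩ := exists_inter_notMem_ideal (C := fun x => f ⁻¹' {x}) (finite_univ (α := X))
    hB (fun a _ => by simp)
  exact convergesBelow_of_fiber_notMem_ideal hx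

theorem FinBW.seqCompactSpace [Countable Ω] [Countable Λ] (h : ρ.FinBW X) :
    SeqCompactSpace X := by
  obtain ⟨e, he⟩ := exists_injective_nat Λ
  refine ⟨fun s _ => ?_⟩
  obtain ⟨F, hF, -, x, hx⟩ := finBW_iff.1 h fun a => s (e a)
  obtain ⟨b, hbF, hb⟩ := exists_seq_tendsto_tail hF
  have heb : Tendsto (e ∘ b) atTop atTop := by
    simpa only [Nat.cofinite_eq_atTop] using he.tendsto_cofinite.comp hb
  obtain ⟨φ, hφ, hmono⟩ := strictMono_subseq_of_tendsto_atTop heb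
  exact ⟨x, mem_univ x, e ∘ b ∘ φ, hmono, hx.comp (hbF.comp hφ.tendsto_atTop)⟩

end ConvergesBelow

/-! ### The `P⁻` properties as diagonalization against the ideal -/

/-- `P⁻` below a fixed set `B`. Instead of a decreasing sequence `A n` starting at `B` it is stated
for the small sets `C n`, which stand for the differences `A n \ A (n + 1)`. -/
def IsPMinusOn (ρ : PartitionRegularFunction Ω Λ) (B : Set Λ) : Prop :=
  ∀ C : ℕ → Set Λ, (∀ n, C n ∈ ρ.ideal) →
    ∃ F ∈ ρ.family, ρ F ⊆ B ∧ ∀ n, ∀ᶠ a in ρ.tail F, a ∉ C n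

theorem IsPMinusOn.exists_almostSubset (h : ρ.IsPMinusOn B) {A : ℕ → Set Λ} (hA0 : A 0 = B)
    (hdiff : ∀ n, A n \ A (n + 1) ∈ ρ.ideal) :
    ∃ F ∈ ρ.family, ∀ n, ρ.AlmostSubset F (A n) := by
  obtain ⟨F, hF, hFB, havoid⟩ := h _ hdiff
  refine ⟨F, hF, fun n => (mem_tail hF).1 ?_⟩
  induction n with
  | zero => exact eventually_mem_tail hF (hA0 ▸ hFB)
  | succ n ih =>
    filter_upwards [ih, havoid n] with a ha hnot
    exact not_not.1 fun hsucc => hnot ⟨ha, hsucc⟩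

theorem isPMinusOn_of_exists_almostSubset (hB : B ∉ ρ.ideal)
    (h : ∀ A : ℕ → Set Λ, A 0 = B → (∀ n, A (n + 1) ⊆ A n) → (∀ n, A n ∉ ρ.ideal) →
      (∀ n, A n \ A (n + 1) ∈ ρ.ideal) → ∃ F ∈ ρ.family, ∀ n, ρ.AlmostSubset F (A n)) :
    ρ.IsPMinusOn B := by
  intro C hC
  let A (n : ℕ) : Set Λ := B \ ⋃ k < n, C k
  have hA0 : A 0 = B := by simp [A]
  have hsucc (n : ℕ) : A (n + 1) = A n \ C n := by
    simp only [A, biUnion_lt_succ, sdiff_sdiff]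
  have hpos (n : ℕ) : A n ∉ ρ.ideal := fun hn =>
    hB <| mem_ideal_of_subset
      (union_mem_ideal hn (biUnion_mem_ideal (finite_lt_nat n) fun k _ => hC k))
      (subset_sdiff_union B _)
  have hdiff (n : ℕ) : A n \ A (n + 1) ∈ ρ.ideal :=
    mem_ideal_of_subset (hC n) (by rw [hsucc, sdiff_sdiff_right_self]; exact inter_subset_right)
  obtain ⟨F, hF, hFA⟩ := h A hA0 (fun n => hsucc n ▸ sdiff_subset) hpos hdiff
  obtain ⟨E, hE, hEB, hle⟩ := exists_tail_le_of_mem_tail hF ((mem_tail hF).2 (hA0 ▸ hFA 0))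
  refine ⟨E, hE, hEB, fun n => hle ?_⟩
  filter_upwards [(mem_tail hF).2 (hFA (n + 1))] with a ha
  exact (hsucc n ▸ ha).2

theorem isPMinusWhole_iff : ρ.IsPMinusWhole ↔ ρ.IsPMinusOn univ :=
  ⟨isPMinusOn_of_exists_almostSubset univ_notMem_ideal,
    fun h _ hA0 _ _ hdiff => h.exists_almostSubset hA0 hdiff⟩

theorem isPMinus_iff : ρ.IsPMinus ↔ ∀ B ∉ ρ.ideal, ρ.IsPMinusOn B :=
  ⟨fun h _ hB => isPMinusOn_of_exists_almostSubset hB fun A _ => h A,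
    fun h _ _ hpos hdiff => (h _ (hpos 0)).exists_almostSubset rfl hdiff⟩

theorem IsPMinusOn.exists_of_countable (h : ρ.IsPMinusOn B) {ι : Type*} [Countable ι]
    {C : ι → Set Λ} (hC : ∀ i, B ∩ C i ∈ ρ.ideal) :
    ∃ F ∈ ρ.family, ρ F ⊆ B ∧ ∀ i, ∀ᶠ a in ρ.tail F, a ∉ C i := by
  obtain ⟨e, he⟩ := exists_injective_nat ι
  obtain ⟨F, hF, hFB, havoid⟩ := h (fun n => ⋃ i ∈ e ⁻¹' {n}, B ∩ C i) fun n =>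
    biUnion_mem_ideal ((finite_singleton n).preimage he.injOn) fun i _ => hC i
  refine ⟨F, hF, hFB, fun i => ?_⟩
  filter_upwards [toFun_mem_tail hF, havoid (e i)] with a ha hnot hCi
  exact hnot (mem_biUnion (mem_singleton (e i)) ⟨hFB ha, hCi⟩)

theorem IsPMinusOn.exists_tendsto_cofinite [Countable Λ] (h : ρ.IsPMinusOn B) {f : Λ → X}
    (hfiber : ∀ x, B ∩ f ⁻¹' {x} ∈ ρ.ideal) {𝒮 : Set (Set X)} (h𝒮 : 𝒮.Countable)
    (hsmall : ∀ S ∈ 𝒮, B ∩ f ⁻¹' S ∈ ρ.ideal) :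
    ∃ F ∈ ρ.family, ρ F ⊆ B ∧ Tendsto f (ρ.tail F) cofinite ∧
      ∀ S ∈ 𝒮, ∀ᶠ a in ρ.tail F, f a ∉ S := by
  have := h𝒮.to_subtype
  obtain ⟨F, hF, hFB, havoid⟩ := h.exists_of_countable
    (C := Sum.elim (fun a => f ⁻¹' {f a}) fun S : 𝒮 => f ⁻¹' S)
    (by rintro (a | S); exacts [hfiber (f a), hsmall S S.2])
  refine ⟨F, hF, hFB, tendsto_cofinite_iff_eventually_ne.2 fun x => ?_,
    fun S hS => havoid (Sum.inr ⟨S, hS⟩)⟩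
  by_cases hx : x ∈ range f
  · obtain ⟨b, rfl⟩ := hx
    exact havoid (Sum.inl b)
  · exact Eventually.of_forall fun a ha => hx ⟨a, ha⟩

/-! ### Infinite Hausdorff spaces -/

theorem tendsto_cofinite_of_tendsto_comp_isEmbedding {D : Type*} [TopologicalSpace D]
    [DiscreteTopology D] [TopologicalSpace X] [T1Space X] {e : D → X} (he : IsEmbedding e)
    {f : Λ → D} {x : X} (hF : F ∈ ρ.family) (hfiber : ∀ d, ρ F ∩ f ⁻¹' {d} ∈ ρ.ideal)
    (hlim : Tendsto (e ∘ f) (ρ.tail F) (𝓝 x)) : Tendsto f (ρ.tail F) cofinite := by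
  refine tendsto_cofinite_iff_eventually_ne.2 fun d => ?_
  by_cases hd : x = e d
  · have hconst : ∀ᶠ a in ρ.tail F, f a = d := by
      have := he.tendsto_nhds_iff.2 (hd ▸ hlim)
      rwa [nhds_discrete, tendsto_pure] at this
    exact absurd (hfiber d) (notMem_ideal_of_mem_tail hF (inter_mem (toFun_mem_tail hF) hconst))
  · exact (hlim.eventually_ne hd).mono fun a hne had => hne (congrArg e had)

theorem isPMinusOn_of_forall_convergesBelow [TopologicalSpace X] [T2Space X] [Infinite X]
    (h : ∀ f : Λ → X, ρ.ConvergesBelow B f) : ρ.IsPMinusOn B := by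
  intro C hC
  by_cases hrest : B \ ⋃ n, C n ∈ ρ.ideal
  swap
  · obtain ⟨F, hF, hFB⟩ := exists_toFun_subset hrest
    refine ⟨F, hF, hFB.trans sdiff_subset, fun n => ?_⟩
    exact eventually_mem_tail hF fun a ha hn => (hFB ha).2 (mem_iUnion_of_mem n hn)
  -- A limit of `rank` along an infinite discrete subset of `X` forces `rank` to tend to infinity.
  let rank (a : Λ) : ℕ := sInf {n | a ∈ C n}
  have hfiber (n : ℕ) : B ∩ rank ⁻¹' {n} ∈ ρ.ideal := by
    refine mem_ideal_of_subset (union_mem_ideal hrest (hC n)) ?_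
    rintro a ⟨haB, rfl⟩
    by_cases ha : a ∈ ⋃ n, C n
    · exact Or.inr (Nat.sInf_mem (mem_iUnion.1 ha))
    · exact Or.inl ⟨haB, ha⟩
  obtain ⟨e, he⟩ := exists_topology_isEmbedding_nat X
  obtain ⟨F, hF, hFB, x, hlim⟩ := h (e ∘ rank)
  have hrank : Tendsto rank (ρ.tail F) atTop := by
    rw [← Nat.cofinite_eq_atTop]
    exact tendsto_cofinite_of_tendsto_comp_isEmbedding he hF
      (fun n => mem_ideal_of_subset (hfiber n) (inter_subset_inter_left _ hFB)) hlim
  refine ⟨F, hF, hFB, fun n => ?_⟩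
  filter_upwards [hrank.eventually_gt_atTop n] with a ha hn
  exact ha.not_ge (Nat.sInf_le hn)

/-! ### Compact Hausdorff spaces of arbitrary cardinality -/

theorem IsPMinusOn.convergesBelow_onePoint [Countable Λ] [TopologicalSpace X] [DiscreteTopology X]
    (h : ρ.IsPMinusOn B) (f : Λ → OnePoint X) : ρ.ConvergesBelow B f := by
  by_cases hfiber : ∀ x, B ∩ f ⁻¹' {x} ∈ ρ.ideal
  · obtain ⟨F, hF, hFB, hlim, -⟩ := h.exists_tendsto_cofinite hfiber countable_empty (by simp)
    exact ⟨F, hF, hFB, _, hlim.mono_right cofinite_le_nhds_onePoint_infty⟩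
  · push Not at hfiber
    exact convergesBelow_of_fiber_notMem_ideal hfiber.choose_spec

theorem exists_compact_t2_mk_eq [Countable Λ] (ρ : PartitionRegularFunction Ω Λ)
    (κ : Cardinal.{w}) :
    ∃ (X : Type w) (_ : TopologicalSpace X), T2Space X ∧ CompactSpace X ∧ Cardinal.mk X = κ ∧
      ∀ B ∉ ρ.ideal, ρ.IsPMinusOn B → ∀ f : Λ → X, ρ.ConvergesBelow B f := by
  let _ : TopologicalSpace κ.out := ⊥
  have : DiscreteTopology κ.out := ⟨rfl⟩
  rcases lt_or_ge κ Cardinal.aleph0 with hκ | hκ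
  · have : Finite κ.out := Cardinal.lt_aleph0_iff_finite.1 (by rwa [κ.mk_out])
    exact ⟨κ.out, inferInstance, inferInstance, inferInstance, κ.mk_out,
      fun _ hB _ => convergesBelow_of_finite hB⟩
  · refine ⟨OnePoint κ.out, inferInstance, inferInstance, inferInstance, ?_,
      fun _ _ h => h.convergesBelow_onePoint⟩
    rw [OnePoint, Cardinal.mk_option, κ.mk_out, Cardinal.add_one_of_aleph0_le hκ]

theorem isPMinusWhole_tfae [Countable Λ] (ρ : PartitionRegularFunction Ω Λ) :
    [ρ.IsPMinusWhole,
      ∀ κ : Cardinal.{w}, ∃ (X : Type w) (_ : TopologicalSpace X),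
        T2Space X ∧ CompactSpace X ∧ Cardinal.mk X = κ ∧ ρ.FinBW X,
      ∃ (X : Type w) (_ : TopologicalSpace X), Infinite X ∧ T2Space X ∧ ρ.FinBW X].TFAE := by
  tfae_have 1 → 2 := fun h κ => by
    obtain ⟨X, _, hT2, hcompact, hcard, hX⟩ := exists_compact_t2_mk_eq ρ κ
    exact ⟨X, _, hT2, hcompact, hcard,
      finBW_iff.2 (hX univ univ_notMem_ideal (isPMinusWhole_iff.1 h))⟩
  tfae_have 2 → 3 := fun h => by
    obtain ⟨X, _, hT2, -, hcard, hX⟩ := h Cardinal.aleph0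
    exact ⟨X, _, Cardinal.infinite_iff.2 hcard.ge, hT2, hX⟩
  tfae_have 3 → 1 := fun ⟨X, _, _, _, hX⟩ =>
    isPMinusWhole_iff.2 (isPMinusOn_of_forall_convergesBelow (finBW_iff.1 hX))
  tfae_finish

theorem isPMinus_tfae [Countable Λ] (ρ : PartitionRegularFunction Ω Λ) :
    [ρ.IsPMinus,
      ∀ κ : Cardinal.{w}, ∃ (X : Type w) (_ : TopologicalSpace X),
        T2Space X ∧ CompactSpace X ∧ Cardinal.mk X = κ ∧ ρ.HFinBW X,
      ∃ (X : Type w) (_ : TopologicalSpace X), Infinite X ∧ T2Space X ∧ ρ.HFinBW X].TFAE := by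
  tfae_have 1 → 2 := fun h κ => by
    obtain ⟨X, _, hT2, hcompact, hcard, hX⟩ := exists_compact_t2_mk_eq ρ κ
    exact ⟨X, _, hT2, hcompact, hcard,
      hFinBW_iff.2 fun B hB => hX B hB (isPMinus_iff.1 h B hB)⟩
  tfae_have 2 → 3 := fun h => by
    obtain ⟨X, _, hT2, -, hcard, hX⟩ := h Cardinal.aleph0
    exact ⟨X, _, Cardinal.infinite_iff.2 hcard.ge, hT2, hX⟩
  tfae_have 3 → 1 := fun ⟨X, _, _, _, hX⟩ =>
    isPMinus_iff.2 fun B hB => isPMinusOn_of_forall_convergesBelow (hFinBW_iff.1 hX B hB)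
  tfae_finish

/-! ### The properties weak `P⁺` and `P⁺` -/

theorem exists_mapsTo_ball [PseudoMetricSpace X] [CompactSpace X] (hB : B ∉ ρ.ideal) (f : Λ → X)
    {ε : ℝ} (hε : 0 < ε) :
    ∃ F ∈ ρ.family, ρ F ⊆ B ∧ ∃ x, MapsTo f (ρ F) (Metric.ball x ε) := by
  obtain ⟨t, -, ht, hcover⟩ := finite_cover_balls_of_compact (isCompact_univ (X := X)) hε
  obtain ⟨x, -, hx⟩ := exists_inter_notMem_ideal ht (C := fun x => f ⁻¹' Metric.ball x ε) hB
    fun a _ => by simpa using hcover (mem_univ (f a))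
  obtain ⟨F, hF, hFB⟩ := exists_toFun_subset hx
  exact ⟨F, hF, hFB.trans inter_subset_left, x, fun a ha => (hFB ha).2⟩

theorem exists_antitone_seq_mapsTo_ball [PseudoMetricSpace X] [CompactSpace X]
    (hF : F ∈ ρ.family) (f : Λ → X) :
    ∃ S : ℕ → ρ.family, ρ (S 0) ⊆ ρ F ∧ (∀ n, ρ (S (n + 1)) ⊆ ρ (S n)) ∧
      ∃ c : ℕ → X, ∀ n, MapsTo f (ρ (S (n + 1))) (Metric.ball (c n) (1 / (n + 1))) := by
  choose next hnext hsub c hball using fun (n : ℕ) (T : ρ.family) =>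
    exists_mapsTo_ball (toFun_notMem_ideal T.2) f (Nat.one_div_pos_of_nat (α := ℝ) (n := n))
  let S (n : ℕ) : ρ.family := n.rec ⟨F, hF⟩ fun n T => ⟨next n T, hnext n T⟩
  exact ⟨S, Subset.rfl, fun n => hsub n (S n), fun n => c n (S n), fun n => hball n (S n)⟩

theorem IsWeakPPlus.convergesBelow [PseudoMetricSpace X] [CompactSpace X] (h : ρ.IsWeakPPlus)
    (hB : B ∉ ρ.ideal) (f : Λ → X) : ρ.ConvergesBelow B f := by
  obtain ⟨E, hE, hEB⟩ := exists_toFun_subset hB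
  obtain ⟨F, hF, hFE, hdiag⟩ := h E hE
  obtain ⟨S, hS0, hanti, c, hball⟩ := exists_antitone_seq_mapsTo_ball hF f
  have hSF (n : ℕ) : ρ (S n) ⊆ ρ F :=
    (antitone_nat_of_succ_le (f := fun n => ρ (S n)) hanti n.zero_le).trans hS0
  obtain ⟨G, hG, hGS⟩ := hdiag (fun n => S n) (fun n => (S n).2) hSF hanti
  have hmem (n : ℕ) : ρ (S n) ∈ ρ.tail G := (mem_tail hG).2 (hGS n)
  have := tail_neBot hG
  have hcauchy : Cauchy (map f (ρ.tail G)) := by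
    refine Metric.cauchy_iff.2 ⟨inferInstance, fun ε hε => ?_⟩
    obtain ⟨n, hn⟩ := exists_nat_one_div_lt (half_pos hε)
    refine ⟨f '' ρ (S (n + 1)), image_mem_map (hmem (n + 1)), ?_⟩
    rintro _ ⟨a, ha, rfl⟩ _ ⟨b, hb, rfl⟩
    calc dist (f a) (f b) ≤ dist (f a) (c n) + dist (f b) (c n) := dist_triangle_right _ _ _
      _ < ε / 2 + ε / 2 := add_lt_add ((hball n ha).trans hn) ((hball n hb).trans hn)
      _ = ε := add_halves ε
  obtain ⟨x, hx⟩ := CompleteSpace.complete hcauchy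
  exact (convergesBelow_of_tendsto hG (hmem 0) hx).mono ((hSF 0).trans (hFE.trans hEB))

theorem IsWeakPPlus.hFinBW [PseudoMetricSpace X] [CompactSpace X] (h : ρ.IsWeakPPlus) :
    ρ.HFinBW X :=
  hFinBW_iff.2 fun _ => h.convergesBelow

theorem exists_forall_nhds_preimage_notMem_ideal [TopologicalSpace X] [CompactSpace X]
    (hB : B ∉ ρ.ideal) (f : Λ → X) : ∃ x, ∀ U ∈ 𝓝 x, B ∩ f ⁻¹' U ∉ ρ.ideal := by
  by_contra! hsmall
  choose U hU hI using hsmall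
  obtain ⟨t, -, ht⟩ := isCompact_univ.elim_nhds_subcover U fun x _ => hU x
  obtain ⟨x, -, hx⟩ := exists_inter_notMem_ideal t.finite_toSet (C := fun x => f ⁻¹' U x) hB
    fun a _ => by simpa using ht (mem_univ (f a))
  exact hx (hI x)

theorem IsPPlus.convergesBelow [TopologicalSpace X] [CompactSpace X] [FirstCountableTopology X]
    (h : ρ.IsPPlus) (hB : B ∉ ρ.ideal) (f : Λ → X) : ρ.ConvergesBelow B f := by
  obtain ⟨x, hx⟩ := exists_forall_nhds_preimage_notMem_ideal hB f
  obtain ⟨U, hU⟩ := (𝓝 x).exists_antitone_basis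
  obtain ⟨F, hF, hFU⟩ := h (fun n => B ∩ f ⁻¹' U n)
    (fun n => inter_subset_inter_right _ (preimage_mono (hU.antitone n.le_succ)))
    (fun n => hx _ (hU.mem n))
  have hmem (n : ℕ) : B ∩ f ⁻¹' U n ∈ ρ.tail F := (mem_tail hF).2 (hFU n)
  exact convergesBelow_of_tendsto hF (mem_of_superset (hmem 0) inter_subset_left)
    (hU.tendsto_right_iff.2 fun n _ => mem_of_superset (hmem n) inter_subset_right)

theorem IsPPlus.hFinBW [Countable Λ] [TopologicalSpace X] (h : ρ.IsPPlus) (hX : PropertyStar X) :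
    ρ.HFinBW X := by
  refine hFinBW_iff.2 fun B hB f => ?_
  obtain ⟨hcompact, _⟩ := hX (range f) (countable_range f)
  have := isCompact_iff_compactSpace.1 hcompact
  obtain ⟨F, hF, hFB, x, hx⟩ :=
    h.convergesBelow hB fun a => (⟨f a, subset_closure (mem_range_self a)⟩ : closure (range f))
  exact ⟨F, hF, hFB, x, (continuous_subtype_val.tendsto x).comp hx⟩

/-! ### Well-ordered spaces -/

theorem IsPMinus.hFinBW_of_wellFoundedLT [Countable Λ] [LinearOrder X] [WellFoundedLT X]
    [TopologicalSpace X] [OrderTopology X] (hIio : ∀ x : X, (Iio x).Countable)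
    (hbdd : ∀ s : Set X, s.Countable → BddAbove s) (h : ρ.IsPMinus) : ρ.HFinBW X := by
  refine hFinBW_iff.2 fun B hB f => ?_
  have hpos : {x | B ∩ f ⁻¹' Iic x ∉ ρ.ideal}.Nonempty := by
    obtain ⟨x, hx⟩ := hbdd (range f) (countable_range f)
    refine ⟨x, ?_⟩
    have hall : B ∩ f ⁻¹' Iic x = B :=
      inter_eq_left.2 fun a _ => hx (mem_range_self a)
    rwa [mem_ofPred_eq, hall]
  obtain ⟨x, hx, hmin⟩ := wellFounded_lt.has_min _ hpos
  have hsmall (y : Iio x) : (B ∩ f ⁻¹' Iic x) ∩ f ⁻¹' Iic y.1 ∈ ρ.ideal :=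
    mem_ideal_of_subset (not_not.1 fun hy => hmin y hy y.2)
      (inter_subset_inter_left _ inter_subset_left)
  have := (hIio x).to_subtype
  obtain ⟨F, hF, hFx, havoid⟩ := (isPMinus_iff.1 h _ hx).exists_of_countable hsmall
  refine ⟨F, hF, hFx.trans inter_subset_left, x,
    tendsto_order.2 ⟨fun y hy => ?_, fun y hy => ?_⟩⟩
  · exact (havoid ⟨y, hy⟩).mono fun a => not_le.1
  · exact eventually_mem_tail hF fun a ha => (hFx ha).2.trans_lt hy

end PartitionRegularFunction

namespace OmegaOne

instance : WellFoundedLT OmegaOne.{w} :=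
  inferInstanceAs (WellFoundedLT (Ordinal.omega.{w} 1).ToType)

theorem mk_eq : Cardinal.mk OmegaOne.{w} = Cardinal.aleph 1 := by
  rw [OmegaOne, Cardinal.mk_toType, Ordinal.card_omega]

instance : Uncountable OmegaOne.{w} := by
  rw [← Cardinal.aleph0_lt_mk_iff, mk_eq]
  exact Cardinal.aleph0_lt_aleph_one

theorem countable_Iio (a : OmegaOne.{w}) : (Iio a).Countable := by
  have hord : (Cardinal.mk OmegaOne.{w}).ord = Ordinal.type ((· < ·) : OmegaOne → _ → Prop) := by
    rw [mk_eq, Cardinal.ord_aleph]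
    exact (Ordinal.type_toType _).symm
  have hlt := Cardinal.mk_Iio_lt a hord
  rwa [mk_eq, ← Cardinal.succ_aleph0, Order.lt_succ_iff,
    Cardinal.le_aleph0_iff_set_countable] at hlt

theorem countable_Iic (a : OmegaOne.{w}) : (Iic a).Countable := by
  rw [← Iio_insert]
  exact (countable_Iio a).insert a

theorem bddAbove_of_countable {s : Set OmegaOne.{w}} (hs : s.Countable) : BddAbove s := by
  have hne : ⋃ a ∈ s, Iic a ≠ univ := fun h =>
    not_countable_univ (h ▸ hs.biUnion fun a _ => countable_Iic a)
  obtain ⟨b, hb⟩ := (ne_univ_iff_exists_notMem _).1 hne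
  exact ⟨b, fun a ha => (not_le.1 fun hba => hb (mem_biUnion ha hba)).le⟩

theorem not_compactSpace : ¬ CompactSpace OmegaOne.{w} := by
  intro
  obtain ⟨a, -, ha⟩ := (isCompact_univ (X := OmegaOne.{w})).exists_isGreatest univ_nonempty
  exact not_countable_univ ((countable_Iic a).mono ha)

end OmegaOne

theorem PartitionRegularFunction.IsPMinus.hFinBW_omegaOne {Ω Λ : Type*} [Countable Λ]
    {ρ : PartitionRegularFunction Ω Λ} (h : ρ.IsPMinus) : ρ.HFinBW OmegaOne.{w} :=
  h.hFinBW_of_wellFoundedLT OmegaOne.countable_Iio fun _ => OmegaOne.bddAbove_of_countable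

/-! ### Mrówka spaces -/

/-- Two sets are almost disjoint if their intersection is finite. -/
def AlmostDisjoint {α : Type*} (s t : Set α) : Prop := (s ∩ t).Finite

theorem AlmostDisjoint.symm {α : Type*} {s t : Set α} (h : AlmostDisjoint s t) :
    AlmostDisjoint t s := by
  rwa [AlmostDisjoint, inter_comm]

/-- The one-point compactification of the Mrówka space (`Ψ`-space) of a family `A` of subsets of
`N`: the points of `N` are isolated, and the neighbourhoods of the limit point of `A i` are the sets
that contain it and almost all of `A i`. The space is compact if the family is almost disjoint. -/
inductive MrowkaCompactification {N : Type u} {I : Type v} (A : I → Set N) : Type (max u v)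
  | point (n : N)
  | limit (i : I)
  | infty

namespace MrowkaCompactification

variable {N I α : Type*} {A : I → Set N}

variable (A) in
/-- The basic clopen neighbourhood of `limit i`. -/
def cell (i : I) : Set (MrowkaCompactification A) := insert (limit i) (point '' A i)

open scoped Classical in
/-- The indicator functions of the isolated points and of the cells; they define the topology. -/
noncomputable def code (x : MrowkaCompactification A) : N ⊕ I → Bool :=
  Sum.elim (fun n => decide (x = point n)) fun i => decide (x ∈ cell A i)

noncomputable instance : TopologicalSpace (MrowkaCompactification A) := .induced code inferInstance

theorem point_injective : Function.Injective (point : N → MrowkaCompactification A) :=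
  fun _ _ => point.inj

@[simp] theorem point_mem_cell {n : N} {i : I} : point n ∈ cell A i ↔ n ∈ A i := by
  simp [cell]

@[simp] theorem limit_mem_cell {i j : I} : limit j ∈ cell A i ↔ j = i := by
  simp [cell]

@[simp] theorem infty_notMem_cell {i : I} : infty ∉ cell A i := by
  simp [cell]

theorem tendsto_nhds_iff {f : α → MrowkaCompactification A} {l : Filter α}
    {x : MrowkaCompactification A} :
    Tendsto f l (𝓝 x) ↔ (∀ n, ∀ᶠ a in l, f a = point n ↔ x = point n) ∧
      ∀ i, ∀ᶠ a in l, f a ∈ cell A i ↔ x ∈ cell A i := by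
  simp [nhds_induced, tendsto_comap_iff, tendsto_pi_nhds, nhds_discrete, tendsto_pure, code]

theorem tendsto_infty_iff {f : α → MrowkaCompactification A} {l : Filter α} :
    Tendsto f l (𝓝 infty) ↔ (∀ n, ∀ᶠ a in l, f a ≠ point n) ∧ ∀ i, ∀ᶠ a in l, f a ∉ cell A i := by
  simp [tendsto_nhds_iff]

theorem almostDisjoint_cell (hA : Pairwise (AlmostDisjoint on A)) :
    Pairwise (AlmostDisjoint on cell A) := by
  refine fun i j hij => ((hA hij).image point).subset ?_
  rintro (n | k | _) ⟨hi, hj⟩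
  · exact mem_image_of_mem _ ⟨point_mem_cell.1 hi, point_mem_cell.1 hj⟩
  · exact absurd ((limit_mem_cell.1 hi).symm.trans (limit_mem_cell.1 hj)) hij
  · exact absurd hi infty_notMem_cell

theorem tendsto_limit (hA : Pairwise (AlmostDisjoint on A)) {f : α → MrowkaCompactification A}
    {l : Filter α} (hf : Tendsto f l cofinite) {i : I} (hi : ∀ᶠ a in l, f a ∈ cell A i) :
    Tendsto f l (𝓝 (limit i)) := by
  rw [tendsto_nhds_iff]
  refine ⟨fun n => by simpa using hf.eventually (eventually_cofinite_ne (point n)), fun j => ?_⟩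
  obtain rfl | hij := eq_or_ne i j
  · simpa using hi
  · filter_upwards [hi, hf (almostDisjoint_cell hA hij).compl_mem_cofinite] with a hai haij
    simpa [hij] using fun haj => haij ⟨hai, haj⟩

theorem code_injective : Function.Injective (code (A := A)) := by
  intro x y hxy
  have hpoint (n : N) : x = point n ↔ y = point n := by simpa [code] using congrFun hxy (Sum.inl n)
  have hcell (i : I) : x ∈ cell A i ↔ y ∈ cell A i := by simpa [code] using congrFun hxy (Sum.inr i)
  rcases x with n | i | _
  · exact ((hpoint n).1 rfl).symm
  · rcases y with n | j | _
    · exact (hpoint n).2 rfl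
    · rw [limit_mem_cell.1 ((hcell j).2 (limit_mem_cell.2 rfl))]
    · exact absurd ((hcell i).1 (limit_mem_cell.2 rfl)) infty_notMem_cell
  · rcases y with n | j | _
    · exact (hpoint n).2 rfl
    · exact absurd ((hcell j).2 (limit_mem_cell.2 rfl)) infty_notMem_cell
    · rfl

instance : T2Space (MrowkaCompactification A) :=
  T2Space.of_injective_continuous code_injective continuous_induced_dom

theorem exists_inf_principal_le_nhds (hA : Pairwise (AlmostDisjoint on A))
    (l : Filter (MrowkaCompactification A)) [l.NeBot] :
    ∃ S, (∃ᶠ y in l, y ∈ S) ∧ ∃ x, l ⊓ 𝓟 S ≤ 𝓝 x := by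
  by_cases hpt : ∃ x, ∃ᶠ y in l, y = x
  · obtain ⟨x, hx⟩ := hpt
    refine ⟨{x}, hx, x, inf_le_right.trans ?_⟩
    rw [principal_singleton]
    exact pure_le_nhds x
  have hl : l ≤ cofinite := by
    simpa only [le_cofinite_iff_eventually_ne, not_exists, not_frequently] using hpt
  by_cases hcell : ∃ i, ∃ᶠ y in l, y ∈ cell A i
  · obtain ⟨i, hi⟩ := hcell
    exact ⟨cell A i, hi, limit i,
      tendsto_limit hA (f := id) (inf_le_left.trans hl) (mem_inf_of_right (mem_principal_self _))⟩
  · refine ⟨univ, Frequently.of_forall mem_univ, infty, inf_le_left.trans ?_⟩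
    refine tendsto_infty_iff (f := id).2 ⟨fun n => hl (eventually_cofinite_ne _), ?_⟩
    simpa only [not_exists, not_frequently, id] using hcell

theorem compactSpace (hA : Pairwise (AlmostDisjoint on A)) :
    CompactSpace (MrowkaCompactification A) := by
  refine ⟨fun l _ _ => ?_⟩
  obtain ⟨S, hS, x, hx⟩ := exists_inf_principal_le_nhds hA l
  have : (l ⊓ 𝓟 S).NeBot := frequently_mem_iff_neBot.1 hS
  exact ⟨x, mem_univ x, this.mono (le_inf hx inf_le_left)⟩

theorem seqCompactSpace (hA : Pairwise (AlmostDisjoint on A)) :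
    SeqCompactSpace (MrowkaCompactification A) := by
  refine ⟨fun s _ => ?_⟩
  obtain ⟨S, hS, x, hx⟩ := exists_inf_principal_le_nhds hA (map s atTop)
  obtain ⟨φ, hφ, hφS⟩ := extraction_of_frequently_atTop (frequently_map.1 hS)
  refine ⟨x, mem_univ x, φ, hφ, Tendsto.mono_right ?_ hx⟩
  exact tendsto_inf.2 ⟨tendsto_map.comp hφ.tendsto_atTop, tendsto_principal.2 (.of_forall hφS)⟩

theorem separableSpace [Countable N] (hA : Pairwise (AlmostDisjoint on A))
    (hinf : ∀ i, (A i).Infinite) : TopologicalSpace.SeparableSpace (MrowkaCompactification A) := by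
  refine ⟨insert infty (range point), (countable_range _).insert _, ?_⟩
  rintro (n | i | _)
  · exact subset_closure (Or.inr (mem_range_self n))
  · have : (cofinite ⊓ 𝓟 (A i)).NeBot := cofinite_inf_principal_neBot_iff.2 (hinf i)
    have hlim : Tendsto point (cofinite ⊓ 𝓟 (A i)) (𝓝 (limit i)) :=
      tendsto_limit hA (point_injective.tendsto_cofinite.mono_left inf_le_left)
        (mem_inf_of_right fun n hn => point_mem_cell.2 hn)
    exact mem_closure_of_tendsto hlim (.of_forall fun n => Or.inr (mem_range_self n))
  · exact subset_closure (mem_insert _ _)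

theorem mk_eq {N : Type u} {I : Type v} (A : I → Set N) :
    Cardinal.mk (MrowkaCompactification A) =
      Cardinal.lift.{v} (Cardinal.mk N) + Cardinal.lift.{u} (Cardinal.mk I) + 1 := by
  have e : MrowkaCompactification A ≃ Option (N ⊕ I) :=
    { toFun := fun
        | point n => some (.inl n)
        | limit i => some (.inr i)
        | infty => none
      invFun := fun
        | some (.inl n) => point n
        | some (.inr i) => limit i
        | none => infty
      left_inv := by rintro (_ | _ | _) <;> rfl
      right_inv := by rintro (_ | _ | _) <;> rfl }
  rw [e.cardinal_eq, Cardinal.mk_option, Cardinal.mk_sum]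

end MrowkaCompactification

namespace PartitionRegularFunction

open MrowkaCompactification

variable {Ω Λ N I X : Type*} {ρ : PartitionRegularFunction Ω Λ} {A : I → Set N} {B : Set Λ}

/-! ### Tall functions and sequentially compact spaces -/

theorem finBW_of_not_tall [TopologicalSpace X] [SeqCompactSpace X] (h : ¬ ρ.Tall) :
    ρ.FinBW X := by
  simp only [Tall, not_forall, not_exists, not_and] at h
  obtain ⟨A, hA, hpos⟩ := h
  refine finBW_iff.2 fun f => ?_
  have hinj : Function.Injective fun n => (hA.natEmbedding A n : Λ) :=
    Subtype.val_injective.comp (hA.natEmbedding A).injective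
  obtain ⟨x, φ, hφ, hx⟩ := SeqCompactSpace.tendsto_subseq fun n => f (hA.natEmbedding A n)
  let s (n : ℕ) : Λ := hA.natEmbedding A (φ n)
  have hs : Function.Injective s := hinj.comp hφ.injective
  obtain ⟨F, hF, hFs⟩ := exists_toFun_subset <| hpos (range s)
    (range_subset_iff.2 fun n => (hA.natEmbedding A (φ n)).2) (infinite_range_of_injective hs)
  obtain ⟨E, hE, hEF, hcofinite⟩ := exists_tail_le_cofinite hF
  have htail : ρ.tail E ≤ map s atTop := by
    rw [← Nat.cofinite_eq_atTop, ← hs.comap_cofinite_eq, map_comap]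
    exact le_inf hcofinite (le_principal_iff.2 (eventually_mem_tail hE (hEF.trans hFs)))
  have hlim : Tendsto f (map s atTop) (𝓝 x) := tendsto_map'_iff.2 hx
  exact ⟨E, hE, subset_univ _, x, hlim.mono_left htail⟩

theorem exists_almostDisjoint_family {𝓘 : Set (Set N)}
    (h : ∀ S : Set N, S.Infinite → ∃ T ⊆ S, T.Infinite ∧ T ∈ 𝓘) :
    ∃ 𝒜 ⊆ 𝓘, 𝒜.Pairwise AlmostDisjoint ∧ ∀ S : Set N, S.Infinite → ∃ A ∈ 𝒜, (A ∩ S).Infinite := by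
  obtain ⟨𝒜, h𝒜⟩ := zorn_subset {𝒜 | 𝒜 ⊆ 𝓘 ∧ 𝒜.Pairwise AlmostDisjoint} fun c hc hchain =>
    ⟨⋃₀ c, ⟨sUnion_subset fun s hs => (hc hs).1,
      (pairwise_sUnion hchain.directedOn).2 fun s hs => (hc hs).2⟩,
      fun _ => subset_sUnion_of_mem⟩
  refine ⟨𝒜, h𝒜.prop.1, h𝒜.prop.2, fun S hS => ?_⟩
  by_contra! hfin
  obtain ⟨T, hTS, hT, hT𝓘⟩ := h S hS
  have hAT (A) (hA : A ∈ 𝒜) : AlmostDisjoint A T :=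
    (hfin A hA).subset (inter_subset_inter_right A hTS)
  have hT𝒜 : T ∈ 𝒜 := h𝒜.mem_of_prop_insert ⟨insert_subset hT𝓘 h𝒜.prop.1,
    h𝒜.prop.2.insert fun A hA _ => ⟨(hAT A hA).symm, hAT A hA⟩⟩
  exact hT (inter_self T ▸ hAT T hT𝒜)

theorem not_convergesBelow_point [Countable Ω] [Countable Λ] {e : Λ → N}
    (he : Function.Injective e) (hsmall : ∀ i, e ⁻¹' A i ∈ ρ.ideal)
    (hmax : ∀ S : Set N, S.Infinite → ∃ i, (A i ∩ S).Infinite) :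
    ¬ ρ.ConvergesBelow B fun a => (point (e a) : MrowkaCompactification A) := by
  rintro ⟨F, hF, -, x, hx⟩
  rcases x with n | i | _
  · have hn : ∀ᶠ a in ρ.tail F, a ∈ e ⁻¹' {n} := by simpa using (tendsto_nhds_iff.1 hx).1 n
    have hfin : (e ⁻¹' {n}).Finite := (finite_singleton n).preimage he.injOn
    exact notMem_ideal_of_mem_tail hF hn (mem_ideal_of_finite hfin)
  · have hi : ∀ᶠ a in ρ.tail F, a ∈ e ⁻¹' A i := by simpa using (tendsto_nhds_iff.1 hx).2 i
    exact notMem_ideal_of_mem_tail hF hi (hsmall i)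
  · obtain ⟨b, hbF, hb⟩ := exists_seq_tendsto_tail hF
    obtain ⟨i, hi⟩ := hmax (range (e ∘ b))
      (infinite_range_of_tendsto_cofinite (he.tendsto_cofinite.comp hb))
    have hev : ∀ᶠ n in atTop, (e ∘ b) n ∈ (A i)ᶜ := by
      simpa using hbF.eventually ((tendsto_infty_iff.1 hx).2 i)
    refine hi ((finite_range_sdiff_of_eventually_mem hev).subset ?_)
    rw [Set.sdiff_compl, inter_comm]

theorem Tall.exists_seqCompactSpace_not_finBW [Countable Ω] [Countable Λ] (h : ρ.Tall) :
    ∃ (X : Type w) (_ : TopologicalSpace X), T2Space X ∧ SeqCompactSpace X ∧ ¬ ρ.FinBW X := by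
  have : Infinite Λ := infinite_univ_iff.1 (infinite_of_notMem_ideal (univ_notMem_ideal (ρ := ρ)))
  obtain ⟨e⟩ := nonempty_equiv_of_countable (α := Λ) (β := ULift.{w} ℕ)
  obtain ⟨𝒜, h𝒜, hdisj, hmax⟩ := exists_almostDisjoint_family (𝓘 := {A | e ⁻¹' A ∈ ρ.ideal})
    fun S hS => by
      obtain ⟨T, hTS, hT, hTI⟩ := h (e ⁻¹' S) (hS.preimage (by simp))
      exact ⟨e '' T, image_subset_iff.2 hTS, hT.image e.injective.injOn,
        by rwa [mem_ofPred_eq, e.preimage_image]⟩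
  refine ⟨MrowkaCompactification (Subtype.val : 𝒜 → Set _), inferInstance, inferInstance,
    seqCompactSpace fun A A' hne => hdisj A.2 A'.2 (Subtype.val_injective.ne hne), fun hX => ?_⟩
  refine not_convergesBelow_point e.injective (fun A => h𝒜 A.2) (fun S hS => ?_)
    (finBW_iff.1 hX _)
  obtain ⟨A, hA, hAS⟩ := hmax S hS
  exact ⟨⟨A, hA⟩, hAS⟩

theorem not_tall_iff [Countable Ω] [Countable Λ] (ρ : PartitionRegularFunction Ω Λ) :
    ¬ ρ.Tall ↔ ∀ (X : Type w) [TopologicalSpace X], ρ.FinBW X ↔ SeqCompactSpace X := by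
  refine ⟨fun h X _ => ⟨FinBW.seqCompactSpace, fun _ => finBW_of_not_tall h⟩, fun h htall => ?_⟩
  obtain ⟨X, _, -, hX, hnot⟩ := htall.exists_seqCompactSpace_not_finBW
  exact hnot ((h X).2 hX)

theorem not_tall_iff_t2 [Countable Ω] [Countable Λ] (ρ : PartitionRegularFunction Ω Λ) :
    ¬ ρ.Tall ↔ ∀ (X : Type w) [TopologicalSpace X] [T2Space X], ρ.FinBW X ↔ SeqCompactSpace X := by
  refine ⟨fun h X _ _ => (not_tall_iff ρ).1 h X, fun h htall => ?_⟩
  obtain ⟨X, _, _, hX, hnot⟩ := htall.exists_seqCompactSpace_not_finBW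
  exact hnot ((h X).2 hX)

end PartitionRegularFunction

/-! ### Towers of sets -/

theorem exists_infinite_forall_sdiff_finite {N ι : Type*} [Countable N] [Countable ι]
    {T : ι → Set N} (hT : ∀ s : Set ι, s.Finite → (⋂ j ∈ s, T j).Infinite) :
    ∃ Z : Set N, Z.Infinite ∧ ∀ j, (Z \ T j).Finite := by
  have := isCountablyGenerated_cofinite (α := N)
  have : ((⨅ j, 𝓟 (T j)) ⊓ cofinite).NeBot := by
    refine (hasBasis_iInf_principal_finite T).inf_neBot_iff.2 fun {s} hs {t} ht => ?_
    have ht : tᶜ.Finite := ht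
    simpa only [Set.sdiff_compl] using ((hT s hs).sdiff ht).nonempty
  obtain ⟨b, hb⟩ := exists_seq_tendsto ((⨅ j, 𝓟 (T j)) ⊓ cofinite)
  refine ⟨range b, infinite_range_of_tendsto_cofinite (tendsto_inf.1 hb).2, fun j => ?_⟩
  exact finite_range_sdiff_of_eventually_mem
    (tendsto_principal.1 (tendsto_iInf.1 (tendsto_inf.1 hb).1 j))

/-- A continuation of a tower `T` by a set `T'` that splits off a set `A` disjoint from `T'`. The
predicate `P` stands for smallness; `P A → P T'` says that `A` may be small only if the whole rest
of the tower is small as well. -/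
structure IsTowerStep {ι N : Type*} (T : ι → Set N) (P : Set N → Prop) (A T' : Set N) : Prop where
  infinite_left : A.Infinite
  infinite_right : T'.Infinite
  disjoint : Disjoint A T'
  sdiff_finite : ∀ j, ((A ∪ T') \ T j).Finite
  imp : P A → P T'

theorem exists_isTowerStep {ι N : Type*} [Countable N] [Countable ι] {T : ι → Set N}
    (hT : ∀ s : Set ι, s.Finite → (⋂ j ∈ s, T j).Infinite) (P : Set N → Prop) :
    ∃ A T', IsTowerStep T P A T' := by
  obtain ⟨Z, hZ, hZT⟩ := exists_infinite_forall_sdiff_finite hT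
  obtain ⟨Z₀, Z₁, rfl, hdisj, hcard⟩ := hZ.exists_union_disjoint_cardinal_eq_of_infinite
  obtain ⟨e⟩ := Cardinal.eq.1 hcard
  have hinf : Z₀.Infinite ↔ Z₁.Infinite := by
    rw [← infinite_coe_iff, ← infinite_coe_iff, e.infinite_iff]
  have hZ₀ : Z₀.Infinite := (infinite_union.1 hZ).elim id hinf.2
  by_cases himp : P Z₀ → P Z₁
  · exact ⟨Z₀, Z₁, hZ₀, hinf.1 hZ₀, hdisj, hZT, himp⟩
  · exact ⟨Z₁, Z₀, hinf.1 hZ₀, hZ₀, hdisj.symm, union_comm Z₀ Z₁ ▸ hZT,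
      fun _ => (Classical.not_imp.1 himp).1⟩

theorem exists_transfinite_choice {I D : Type*} [Preorder I] [WellFoundedLT I] [Nonempty D]
    (P : ∀ i : I, (Iio i → D) → D → Prop)
    (h : ∀ (i : I) (p : I → D), (∀ j < i, P j (fun k => p k) (p j)) → ∃ d, P i (fun k => p k) d) :
    ∃ p : I → D, ∀ i, P i (fun k => p k) (p i) := by
  classical
  let next (i : I) (q : ∀ j, j < i → D) : D :=
    if hd : ∃ d, P i (fun k => q k k.2) d then hd.choose else Classical.arbitrary D
  let p : I → D := wellFounded_lt.fix next
  refine ⟨p, fun i => ?_⟩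
  induction i using WellFoundedLT.induction with
  | ind i ih =>
    have hd := h i p ih
    have hp : p i = hd.choose := by
      rw [show p i = next i fun j _ => p j from wellFounded_lt.fix_eq next i]
      exact dif_pos hd
    rw [hp]
    exact hd.choose_spec

/-- A tower indexed by `I` in which every `T i` and `A i` arise by a tower step from the sets before
them. -/
def IsTower {I N : Type*} [Preorder I] (P : I → Set N → Prop) (A T : I → Set N) : Prop :=
  ∀ i, IsTowerStep (fun j : Iio i => T j) (P i) (A i) (T i)

theorem infinite_biInter_of_forall_sdiff_finite {I N : Type*} [Infinite N] [LinearOrder I]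
    {T : I → Set N} {s : Set I} (hs : s.Finite) (hinf : ∀ i ∈ s, (T i).Infinite)
    (hsub : ∀ i ∈ s, ∀ j ∈ s, i < j → (T j \ T i).Finite) : (⋂ i ∈ s, T i).Infinite := by
  obtain rfl | hne := s.eq_empty_or_nonempty
  · simpa using infinite_univ
  obtain ⟨m, hm, hmax⟩ := s.exists_max_image id hs hne
  have hfin : (⋃ i ∈ s, T m \ T i).Finite := hs.biUnion fun i hi => by
    obtain rfl | hlt := (hmax i hi).eq_or_lt
    · simp
    · exact hsub i hi m hm hlt
  refine ((hinf m hm).sdiff hfin).mono fun n hn => mem_iInter₂.2 fun i hi => ?_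
  exact not_not.1 fun hni => hn.2 (mem_biUnion hi ⟨hn.1, hni⟩)

theorem exists_isTower {I N : Type*} [Countable N] [Infinite N] [LinearOrder I] [WellFoundedLT I]
    (hI : ∀ i : I, (Iio i).Countable) (P : I → Set N → Prop) : ∃ A T, IsTower P A T := by
  obtain ⟨p, hp⟩ := exists_transfinite_choice
    (fun (i : I) q (d : Set N × Set N) => IsTowerStep (fun j => (q j).2) (P i) d.1 d.2)
    fun i p hp => by
      have := (hI i).to_subtype
      have hT (s : Set (Iio i)) (hs : s.Finite) : (⋂ j ∈ s, (p j).2).Infinite :=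
        infinite_biInter_of_forall_sdiff_finite hs (fun j _ => (hp j j.2).infinite_right)
          fun j _ k _ hjk => ((hp k k.2).sdiff_finite ⟨j, hjk⟩).subset
            (sdiff_subset_sdiff_left subset_union_right)
      obtain ⟨A, T', hstep⟩ := exists_isTowerStep hT (P i)
      exact ⟨(A, T'), hstep⟩
  exact ⟨fun i => (p i).1, fun i => (p i).2, hp⟩

theorem IsTower.sdiff_finite {I N : Type*} [Preorder I] {P : I → Set N → Prop} {A T : I → Set N}
    (h : IsTower P A T) {i j : I} (hij : i < j) : (A j \ T i).Finite :=
  ((h j).sdiff_finite ⟨i, hij⟩).subset (sdiff_subset_sdiff_left subset_union_left)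

theorem IsTower.almostDisjoint {I N : Type*} [LinearOrder I] {P : I → Set N → Prop}
    {A T : I → Set N} (h : IsTower P A T) : Pairwise (AlmostDisjoint on A) := by
  have hlt {i j : I} (hij : i < j) : AlmostDisjoint (A i) (A j) :=
    (h.sdiff_finite hij).subset fun n hn =>
      ⟨hn.2, (h i).disjoint.notMem_of_mem_left hn.1⟩
  exact fun i j hij => hij.lt_or_gt.elim hlt fun hji => (hlt hji).symm

/-! ### A separable space under the continuum hypothesis -/

namespace PartitionRegularFunction

open MrowkaCompactification

variable {Ω Λ N I : Type*} {ρ : PartitionRegularFunction Ω Λ} {A T : I → Set N}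
  {B : Set Λ}

theorem IsPMinus.convergesBelow_of_cell_notMem_ideal [Countable Λ] (h : ρ.IsPMinus)
    (hA : Pairwise (AlmostDisjoint on A)) {f : Λ → MrowkaCompactification A}
    (hfiber : ∀ x, B ∩ f ⁻¹' {x} ∈ ρ.ideal) {i : I} (hi : B ∩ f ⁻¹' cell A i ∉ ρ.ideal) :
    ρ.ConvergesBelow B f := by
  obtain ⟨F, hF, hFi, hlim, -⟩ := (isPMinus_iff.1 h _ hi).exists_tendsto_cofinite
    (fun x => mem_ideal_of_subset (hfiber x) (inter_subset_inter_left _ inter_subset_left))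
    countable_empty (by simp)
  exact ⟨F, hF, hFi.trans inter_subset_left, limit i,
    tendsto_limit hA hlim (eventually_mem_tail hF fun a ha => (hFi ha).2)⟩

theorem exists_forall_inter_preimage_eq [Nonempty N] {q : I → Set Λ × (Λ → N)}
    (hq : Function.Surjective q) (B : Set Λ) (f : Λ → MrowkaCompactification A) :
    ∃ i, ∀ S, (q i).1 ∩ (q i).2 ⁻¹' S = B ∩ f ⁻¹' (point '' S) := by
  obtain ⟨i, hi⟩ := hq (B ∩ f ⁻¹' range point, Function.invFun point ∘ f)
  refine ⟨i, fun S => ?_⟩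
  have himage : range (point (A := A)) ∩ Function.invFun point ⁻¹' S = point '' S := by
    rw [inter_comm, ← image_preimage_eq_inter_range, ← preimage_comp,
      Function.invFun_comp point_injective, preimage_id]
  rw [hi, preimage_comp, inter_assoc, ← preimage_inter, himage]

theorem IsPMinus.hFinBW_mrowkaCompactification [Countable Λ] [Nonempty N] [LinearOrder I]
    (hIic : ∀ i : I, (Iic i).Countable) (h : ρ.IsPMinus) {q : I → Set Λ × (Λ → N)}
    (hq : Function.Surjective q)
    (hT : IsTower (fun i S => (q i).1 ∩ (q i).2 ⁻¹' S ∈ ρ.ideal) A T) :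
    ρ.HFinBW (MrowkaCompactification A) := by
  refine hFinBW_iff.2 fun B hB f => ?_
  by_cases hfiber : ∀ x, B ∩ f ⁻¹' {x} ∈ ρ.ideal
  swap
  · push Not at hfiber
    exact convergesBelow_of_fiber_notMem_ideal hfiber.choose_spec
  by_cases hcell : ∀ i, B ∩ f ⁻¹' cell A i ∈ ρ.ideal
  swap
  · push Not at hcell
    exact h.convergesBelow_of_cell_notMem_ideal hT.almostDisjoint hfiber hcell.choose_spec
  obtain ⟨i, hi⟩ := exists_forall_inter_preimage_eq hq B f
  have hAi : B ∩ f ⁻¹' (point '' A i) ∈ ρ.ideal :=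
    mem_ideal_of_subset (hcell i) (inter_subset_inter_right _ (preimage_mono (subset_insert _ _)))
  have hTi : B ∩ f ⁻¹' (point '' T i) ∈ ρ.ideal := by
    rw [← hi] at hAi ⊢
    exact (hT i).imp hAi
  -- Almost all of each later cell lies in `T i`, so only countably many sets have to be avoided.
  obtain ⟨F, hF, hFB, hlim, havoid⟩ := (isPMinus_iff.1 h B hB).exists_tendsto_cofinite hfiber
    (𝒮 := insert (point '' T i) (cell A '' Iic i)) (((hIic i).image _).insert _)
    (forall_mem_insert.2 ⟨hTi, forall_mem_image.2 fun j _ => hcell j⟩)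
  obtain ⟨hTavoid, hcellavoid⟩ := forall_mem_insert.1 havoid
  refine ⟨F, hF, hFB, infty, tendsto_infty_iff.2
    ⟨fun n => tendsto_cofinite_iff_eventually_ne.1 hlim (point n), fun k => ?_⟩⟩
  obtain hki | hik := le_or_gt k i
  · exact hcellavoid _ (mem_image_of_mem _ hki)
  · have hfin : (cell A k \ point '' T i).Finite := by
      refine (((hT.sdiff_finite hik).image point).insert (limit k)).subset ?_
      rw [image_sdiff point_injective, cell, insert_sdiff_of_notMem _ (by simp)]
    filter_upwards [hTavoid, hlim hfin.compl_mem_cofinite] with a haT hak hcell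
    exact hak ⟨hcell, haT⟩

theorem exists_surjective_omegaOne [Countable Λ]
    (hCH : Cardinal.continuum.{w} = Cardinal.aleph 1) :
    ∃ q : OmegaOne.{w} → Set Λ × (Λ → ℕ), Function.Surjective q := by
  have hΛ : Cardinal.mk Λ ≤ Cardinal.aleph0 := Cardinal.mk_le_aleph0
  have hset : Cardinal.mk (Set Λ) ≤ Cardinal.continuum := by
    rw [Cardinal.mk_set, ← Cardinal.two_power_aleph0]
    exact Cardinal.power_le_power_left two_ne_zero hΛ
  have hfun : Cardinal.mk (Λ → ℕ) ≤ Cardinal.continuum := by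
    rw [Cardinal.mk_arrow, Cardinal.mk_nat, Cardinal.lift_aleph0, Cardinal.lift_uzero,
      ← Cardinal.aleph0_power_aleph0]
    exact Cardinal.power_le_power_left Cardinal.aleph0_ne_zero hΛ
  have hprod : Cardinal.mk (Set Λ × (Λ → ℕ)) ≤ Cardinal.continuum := by
    rw [Cardinal.mk_prod, Cardinal.lift_id, Cardinal.lift_id, ← Cardinal.continuum_mul_self]
    exact mul_le_mul' hset hfun
  have hlift := Cardinal.lift_le.{w}.2 hprod
  rw [Cardinal.lift_continuum, ← Cardinal.lift_continuum.{_, w}, hCH, ← OmegaOne.mk_eq] at hlift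
  obtain ⟨f⟩ := Cardinal.lift_mk_le'.1 hlift
  exact ⟨Function.invFun f, Function.invFun_surjective f.injective⟩

theorem IsPMinus.exists_separable_hFinBW [Countable Λ] (h : ρ.IsPMinus)
    (hCH : Cardinal.continuum.{w} = Cardinal.aleph 1) :
    ∃ (X : Type w) (_ : TopologicalSpace X), T2Space X ∧ CompactSpace X ∧
      TopologicalSpace.SeparableSpace X ∧ Cardinal.mk X = Cardinal.continuum ∧ ρ.HFinBW X := by
  obtain ⟨q, hq⟩ := exists_surjective_omegaOne (Λ := Λ) hCH
  obtain ⟨A, T, hT⟩ := exists_isTower OmegaOne.countable_Iio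
    fun i (S : Set ℕ) => (q i).1 ∩ (q i).2 ⁻¹' S ∈ ρ.ideal
  refine ⟨MrowkaCompactification A, inferInstance, inferInstance, compactSpace hT.almostDisjoint,
    separableSpace hT.almostDisjoint fun i => (hT i).infinite_left, ?_,
    h.hFinBW_mrowkaCompactification OmegaOne.countable_Iic hq hT⟩
  rw [mk_eq, OmegaOne.mk_eq, ← hCH]
  simp [Cardinal.add_one_eq Cardinal.aleph0_le_continuum]

end PartitionRegularFunction

open PartitionRegularFunction in
theorem mainTheorem6_general {Ω : Type u} {Λ : Type v} [Countable Ω] [Countable Λ]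
    (ρ : PartitionRegularFunction Ω Λ) :
    ((∀ (X : Type w) [TopologicalSpace X] [Finite X], ρ.FinBW X) ∧
      (∀ (X : Type w) [TopologicalSpace X], ρ.FinBW X → SeqCompactSpace X)) ∧
    ((¬ ρ.Tall ↔ ∀ (X : Type w) [TopologicalSpace X], ρ.FinBW X ↔ SeqCompactSpace X) ∧
      (¬ ρ.Tall ↔
        ∀ (X : Type w) [TopologicalSpace X] [T2Space X], ρ.FinBW X ↔ SeqCompactSpace X)) ∧
    [ρ.IsPMinusWhole,
      ∀ κ : Cardinal.{w}, ∃ (X : Type w) (_ : TopologicalSpace X),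
        T2Space X ∧ CompactSpace X ∧ Cardinal.mk X = κ ∧ ρ.FinBW X,
      ∃ (X : Type w) (_ : TopologicalSpace X), Infinite X ∧ T2Space X ∧ ρ.FinBW X].TFAE ∧
    [ρ.IsPMinus,
      ∀ κ : Cardinal.{w}, ∃ (X : Type w) (_ : TopologicalSpace X),
        T2Space X ∧ CompactSpace X ∧ Cardinal.mk X = κ ∧ ρ.HFinBW X,
      ∃ (X : Type w) (_ : TopologicalSpace X), Infinite X ∧ T2Space X ∧ ρ.HFinBW X].TFAE ∧
    (ρ.IsPMinus →
      (Uncountable OmegaOne.{w} ∧ ¬ CompactSpace OmegaOne.{w} ∧ T2Space OmegaOne.{w} ∧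
        ρ.HFinBW OmegaOne.{w}) ∧
      (Cardinal.continuum.{w} = Cardinal.aleph.{w} 1 →
        ∃ (X : Type w) (_ : TopologicalSpace X), T2Space X ∧ CompactSpace X ∧
          TopologicalSpace.SeparableSpace X ∧ Cardinal.mk X = Cardinal.continuum.{w} ∧
          ρ.HFinBW X)) ∧
    (ρ.IsWeakPPlus → ∀ (X : Type w) [PseudoMetricSpace X] [CompactSpace X], ρ.HFinBW X) ∧
    (ρ.IsPPlus →
      ∀ (X : Type w) [TopologicalSpace X], PropertyStar X → ρ.HFinBW X) := by
  refine ⟨⟨fun X _ _ => finBW_iff.2 (convergesBelow_of_finite univ_notMem_ideal),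
      fun X _ => FinBW.seqCompactSpace⟩,
    ⟨not_tall_iff ρ, not_tall_iff_t2 ρ⟩, isPMinusWhole_tfae ρ, isPMinus_tfae ρ,
    fun h => ⟨?_, h.exists_separable_hFinBW⟩, fun h X _ _ => h.hFinBW, fun h X _ hX => h.hFinBW hX⟩
  exact ⟨inferInstance, OmegaOne.not_compactSpace, inferInstance, h.hFinBW_omegaOne⟩

theorem mainTheorem6 {Ω : Type u} {Λ : Type v} [Countable Ω] [Infinite Ω] [Countable Λ]
    [Infinite Λ] (ρ : PartitionRegularFunction Ω Λ) :
    -- all finite spaces are in `FinBW(ρ)`, and all spaces in `FinBW(ρ)` are sequentially compact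
    ((∀ (X : Type w) [TopologicalSpace X] [Finite X], ρ.FinBW X) ∧
      (∀ (X : Type w) [TopologicalSpace X], ρ.FinBW X → SeqCompactSpace X)) ∧
    -- `ρ` is not tall iff `FinBW(ρ)` is the class of all sequentially compact spaces,
    -- both among all topological spaces and among Hausdorff spaces
    ((¬ ρ.Tall ↔ ∀ (X : Type w) [TopologicalSpace X], ρ.FinBW X ↔ SeqCompactSpace X) ∧
      (¬ ρ.Tall ↔
        ∀ (X : Type w) [TopologicalSpace X] [T2Space X], ρ.FinBW X ↔ SeqCompactSpace X)) ∧
    -- characterizations of `P⁻(Λ)`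
    [ρ.IsPMinusWhole,
      ∀ κ : Cardinal.{w}, ∃ (X : Type w) (_ : TopologicalSpace X),
        T2Space X ∧ CompactSpace X ∧ Cardinal.mk X = κ ∧ ρ.FinBW X,
      ∃ (X : Type w) (_ : TopologicalSpace X), Infinite X ∧ T2Space X ∧ ρ.FinBW X].TFAE ∧
    -- characterizations of `P⁻`
    [ρ.IsPMinus,
      ∀ κ : Cardinal.{w}, ∃ (X : Type w) (_ : TopologicalSpace X),
        T2Space X ∧ CompactSpace X ∧ Cardinal.mk X = κ ∧ ρ.HFinBW X,
      ∃ (X : Type w) (_ : TopologicalSpace X), Infinite X ∧ T2Space X ∧ ρ.HFinBW X].TFAE ∧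
    -- consequences of `P⁻`
    (ρ.IsPMinus →
      (Uncountable OmegaOne.{w} ∧ ¬ CompactSpace OmegaOne.{w} ∧ T2Space OmegaOne.{w} ∧
        ρ.FinBW OmegaOne.{w}) ∧
      (Cardinal.continuum.{w} = Cardinal.aleph.{w} 1 →
        ∃ (X : Type w) (_ : TopologicalSpace X), T2Space X ∧ CompactSpace X ∧
          TopologicalSpace.SeparableSpace X ∧ Cardinal.mk X = Cardinal.continuum.{w} ∧
          ρ.FinBW X)) ∧
    -- consequence of weak `P⁺`
    (ρ.IsWeakPPlus → ∀ (X : Type w) [MetricSpace X] [CompactSpace X], ρ.HFinBW X) ∧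
    -- consequence of `P⁺`
    (ρ.IsPPlus →
      ∀ (X : Type w) [TopologicalSpace X] [T2Space X], PropertyStar X → ρ.HFinBW X) := by
  obtain ⟨hbasic, htall, hwhole, hminus, hexamples, hweak, hplus⟩ :=
    mainTheorem6_general.{u, v, w} ρ
  exact ⟨hbasic, htall, hwhole, hminus,
    fun h => (hexamples h).imp (fun ⟨hunc, hncpt, hT2, hω⟩ => ⟨hunc, hncpt, hT2, hω.finBW⟩)
      fun hsep hCH => (hsep hCH).imp fun _ => .imp fun _ ⟨hT2, hcpt, hdense, hcard, hX⟩ =>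
        ⟨hT2, hcpt, hdense, hcard, hX.finBW⟩,
    fun h X _ _ => hweak h X, fun h X _ _ => hplus h X⟩
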